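/- Let $T$ be an infinite, locally finite tree without leaves (i.e. without vertices of degree $1$). Equip $\mathrm{Aut}(T)$ with the permutation topology, whose basic open sets are $\{g \in \mathrm{Aut}(T) : g(x) = g_0(x) \text{ for all } x \in F\}$ for $g_0 \in \mathrm{Aut}(T)$ and finite sets $F$ of vertices, and equip its subgroups with the induced topology. Let $G \le \mathrm{Aut}(T)$ and $k \in \mathbb{N}$, and use the following terminology. - A permutation group $P \le \mathrm{Sym}(X)$ is semi-primitive if it is transitive and each normal subgroup of $P$ is transitive or semi-regular (that is, only its identity element fixes a point of $X$). The group $G$ is locally semi-primitive if for every vertex $v$ the permutation group that the stabiliser $G_v$ induces on the set of edges incident to $v$ is semi-primitive. - For vertices $v, w$ of an edge $e = \{v,w\}$, let $T_{(v,w)}$ be the component containing $w$ of $T$ with the edge $e$ removed, let $B(v,k)$ be the set of vertices at distance at most $k$ from $v$, and let $F_{k,e}$ be the subgroup of $G$ that fixes $B(v,k) \cap B(w,k)$ pointwise. The group $G$ satisfies Property $P_k$ if for every edge $e = \{v,w\}$ $$F_{k,e} = \mathrm{Fix}_{F_{k,e}}(T_{(v,w)})\,\mathrm{Fix}_{F_{k,e}}(T_{(w,v)}),$$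 where $\mathrm{Fix}$ denotes pointwise stabilisers. - An end of $T$ is an equivalence class of rays (one-sided infinite paths without repeated vertices), two rays being equivalent if their intersection is a ray. - A topological group $\Gamma$ has the closed range property if for every Hausdorff topological group $H$ and every continuous homomorphism $\varphi : \Gamma \to H$ the image $\varphi(\Gamma)$ is closed in $H$. Suppose that $G$ is closed in $\mathrm{Aut}(T)$, non-discrete and locally semi-primitive, that $G$ stabilises (setwise) no proper non-empty subtree of $T$ and fixes no end of $T$, and that $G$ satisfies Property $P_k$. Then $G$ has the closed range property. -/

import Mathlib

open scoped Pointwise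

universe u w

namespace TreeAut

/-- A topological group has the closed range property if each of its continuous homomorphisms
to a (Hausdorff) topological group has closed range. -/
def HasClosedRangeProperty (G : Type u) [Group G] [TopologicalSpace G] [IsTopologicalGroup G] :
    Prop :=
  ∀ (H : Type w) [Group H] [TopologicalSpace H] [IsTopologicalGroup H] [T2Space H]
    (φ : G →* H), Continuous φ → IsClosed (Set.range φ)

/-- A permutation group `P ≤ Sym(X)` is semi-primitive if it is transitive and each of its normal
subgroups is transitive or semi-regular. -/
def IsSemiprimitive {X : Type u} (P : Subgroup (Equiv.Perm X)) : Prop :=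
  MulAction.IsPretransitive P X ∧
    ∀ N : Subgroup P, N.Normal →
      MulAction.IsPretransitive N X ∨ ∀ n ∈ N, ∀ x : X, n • x = x → n = 1

variable {V : Type u} {T : SimpleGraph V}

/-- The basic open set of automorphisms that agree with `g₀` on the finite set `F`. -/
def basicNhd (g₀ : T ≃g T) (F : Finset V) : Set (T ≃g T) :=
  {g | ∀ x ∈ F, g x = g₀ x}

/-- The permutation topology on `Aut(T)`. -/
instance permutationTopology : TopologicalSpace (T ≃g T) :=
  TopologicalSpace.generateFrom {U | ∃ (g₀ : T ≃g T) (F : Finset V), U = basicNhd g₀ F}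

theorem isOpen_basicNhd (g₀ : T ≃g T) (F : Finset V) : IsOpen (basicNhd g₀ F) :=
  TopologicalSpace.isOpen_generateFrom_of_mem ⟨g₀, F, rfl⟩

instance isTopologicalGroup_aut : IsTopologicalGroup (T ≃g T) where
  continuous_mul := by
    classical
    refine continuous_generateFrom_iff.2 ?_
    rintro _ ⟨g₀, F, rfl⟩
    refine isOpen_iff_mem_nhds.2 ?_
    rintro ⟨a, b⟩ hab
    refine Filter.mem_of_superset (prod_mem_nhds
      ((isOpen_basicNhd a (F.image b)).mem_nhds fun _ _ => rfl)
      ((isOpen_basicNhd b F).mem_nhds fun _ _ => rfl)) ?_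
    rintro ⟨a', b'⟩ ⟨ha, hb⟩ x hx
    have h1 : b' x = b x := hb x hx
    have h2 : a' (b x) = a (b x) := ha _ (Finset.mem_image_of_mem _ hx)
    have h3 : a (b x) = g₀ x := hab x hx
    change a' (b' x) = g₀ x
    rw [h1, h2, h3]
  continuous_inv := by
    classical
    refine continuous_generateFrom_iff.2 ?_
    rintro _ ⟨g₀, F, rfl⟩
    refine isOpen_iff_mem_nhds.2 fun a ha => ?_
    refine Filter.mem_of_superset
      ((isOpen_basicNhd a (F.image a.symm)).mem_nhds fun _ _ => rfl) ?_
    intro a' ha' x hx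
    have h1 : a' (a.symm x) = a (a.symm x) := ha' _ (Finset.mem_image_of_mem _ hx)
    have h2 : a.symm x = g₀ x := ha x hx
    change a'.symm x = g₀ x
    rw [← h2, RelIso.symm_apply_eq, h1, RelIso.apply_symm_apply]

/-- The fixator of a set `Y` of vertices in the group `G` of automorphisms. -/
def fixator (G : Subgroup (T ≃g T)) (Y : Set V) : Subgroup (T ≃g T) where
  carrier := {g | g ∈ G ∧ ∀ y ∈ Y, g y = y}
  one_mem' := ⟨G.one_mem, fun _ _ => rfl⟩
  mul_mem' := by
    rintro a b ⟨ha, ha'⟩ ⟨hb, hb'⟩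
    refine ⟨G.mul_mem ha hb, fun y hy => ?_⟩
    change a (b y) = y
    rw [hb' y hy, ha' y hy]
  inv_mem' := by
    rintro a ⟨ha, ha'⟩
    refine ⟨G.inv_mem ha, fun y hy => ?_⟩
    change a.symm y = y
    rw [RelIso.symm_apply_eq, ha' y hy]

/-- The ball `B(v, n)` in `T` (used for connected `T` only). -/
def ball (T : SimpleGraph V) (v : V) (n : ℕ) : Set V :=
  {u | T.dist v u ≤ n}

/-- The half-tree `T_(v,w)`: the component containing `w` of `T` without the edge `{v, w}`. -/
def halfTree (T : SimpleGraph V) (v w : V) : Set V :=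
  {x | (T.deleteEdges {s(v, w)}).Reachable w x}

/-- The group `F_{k,e}` for the edge `e = {v, w}`. -/
def edgeFixator (G : Subgroup (T ≃g T)) (k : ℕ) (v w : V) : Subgroup (T ≃g T) :=
  fixator G (ball T v k ∩ ball T w k)

/-- Property `P_k`: for each edge `{v, w}`, the group `F_{k,e}` is the product of the fixators
in it of the two half-trees. -/
def PropertyP (G : Subgroup (T ≃g T)) (k : ℕ) : Prop :=
  ∀ v w : V, T.Adj v w →
    (edgeFixator G k v w : Set (T ≃g T)) =
      (fixator (edgeFixator G k v w) (halfTree T v w) : Set (T ≃g T)) *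
        (fixator (edgeFixator G k v w) (halfTree T w v) : Set (T ≃g T))

/-- The permutation group induced by the vertex stabiliser `G_v` on the set of edges
incident to `v`. -/
def localAction (G : Subgroup (T ≃g T)) (v : V) :
    Subgroup (Equiv.Perm (T.incidenceSet v)) where
  carrier := {σ | ∃ g ∈ G, g v = v ∧ ∀ e, (σ e : Sym2 V) = Sym2.map g e}
  one_mem' := ⟨1, G.one_mem, rfl, fun e => (congrFun Sym2.map_id (e : Sym2 V)).symm⟩
  mul_mem' := by
    rintro σ τ ⟨a, ha, hav, ha'⟩ ⟨b, hb, hbv, hb'⟩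
    refine ⟨a * b, G.mul_mem ha hb, ?_, fun e => ?_⟩
    · change a (b v) = v
      rw [hbv, hav]
    · rw [Equiv.Perm.mul_apply, ha', hb', Sym2.map_map]
      rfl
  inv_mem' := by
    rintro σ ⟨a, ha, hav, ha'⟩
    refine ⟨a⁻¹, G.inv_mem ha, ?_, fun e => ?_⟩
    · change a.symm v = v
      rw [RelIso.symm_apply_eq, hav]
    · have h := ha' (σ⁻¹ e)
      have hs : σ (σ⁻¹ e) = e := σ.apply_symm_apply e
      rw [hs] at h
      rw [h, Sym2.map_map]
      have : (⇑a⁻¹ ∘ ⇑a) = id := funext fun x => a.symm_apply_apply x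
      rw [this, Sym2.map_id, id]

/-- `G` is locally semi-primitive: each vertex stabiliser acts as a semi-primitive permutation
group on the edges incident to the vertex. -/
def IsLocallySemiprimitive (G : Subgroup (T ≃g T)) : Prop :=
  ∀ v : V, IsSemiprimitive (localAction G v)

/-- `G` stabilises a proper non-empty subtree of `T` (a tree is non-empty by definition). -/
def StabilisesProperSubtree (G : Subgroup (T ≃g T)) : Prop :=
  ∃ S : T.Subgraph, S.coe.IsTree ∧ S ≠ ⊤ ∧ ∀ g ∈ G, S.map g.toHom = S

/-- A ray: a one-sided infinite path without repeated vertices. -/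
structure Ray (T : SimpleGraph V) where
  toFun : ℕ → V
  adj : ∀ n, T.Adj (toFun n) (toFun (n + 1))
  inj : Function.Injective toFun

/-- The image of a ray under an automorphism. -/
def Ray.map (g : T ≃g T) (r : Ray T) : Ray T where
  toFun n := g (r.toFun n)
  adj n := g.map_adj_iff.2 (r.adj n)
  inj := g.injective.comp r.inj

/-- Two rays are equivalent if their intersection is a ray; in a tree the classes are the ends. -/
def Ray.Equivalent (r s : Ray T) : Prop :=
  ∃ t : Ray T, Set.range t.toFun = Set.range r.toFun ∩ Set.range s.toFun

/-- `G` fixes an end of `T`, namely the class of some ray `r`. -/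
def FixesEnd (G : Subgroup (T ≃g T)) : Prop :=
  ∃ r : Ray T, ∀ g ∈ G, (r.map g).Equivalent r

end TreeAut

/-!
Let `φ : G → H` be a continuous homomorphism and suppose that its range is not closed. The kernel
`N` of `φ` is then shown to be so large that the range is compact, hence closed after all.

*The kernel contains every half-tree fixator* (`map_eq_one_of_fixes_halfTree`). Take an ultrafilter
`U` on `G` along which `φ` converges to a point outside the range. Since `G` is closed and `T` is
locally finite, the elements of `G` moving a vertex by a bounded distance form a compact set, so the
vertices `g v` escape to an end of `T` as `g` runs along `U`. If `u ∈ G` fixes a half-tree around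
this end, then `g⁻¹ * u * g → 1` along `U`, while `φ (g⁻¹ * u * g)` converges to a conjugate of
`φ u`; so `φ u = 1`. Every half-tree has a translate around the end: otherwise, `G` being transitive
on undirected edges, the oriented edges pointing to the end would form a `G`-invariant set, and `G`
would fix the end (`exists_halfTree_apply_mem`). Ends are represented by ultrafilters `W` on the
vertex set that are finer than the cofinite filter: the oriented edge `(a, b)` points to the end
if `halfTree T a b ∈ W`.

*The kernel has finitely many orbits on vertices.* By Property `P_k`, `N` contains the open
subgroups `edgeFixator G k a b`. At each vertex the local action of `N` is transitive or
semi-regular. If it were semi-regular everywhere, then only the identity of `N` would fix an edge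
together with its end points (`eq_one_of_locally_semiregular`), and `G` would be discrete. So it is
transitive at some vertex `v`, and then `N` moves every vertex into the ball of radius 2 around `v`
(`exists_dist_apply_le_two`). Hence `φ` has the same range as its restriction to the compact set of
elements that move `v` by at most 2.
-/

namespace TreeAut

variable {V : Type u} {T : SimpleGraph V}

/-! ### Distances and half-trees -/

theorem dist_apply_apply (hT : T.Connected) (g : T ≃g T) (x y : V) :
    T.dist (g x) (g y) = T.dist x y := by
  have key : ∀ (g : T ≃g T) (x y : V), T.dist (g x) (g y) ≤ T.dist x y := by
    intro g x y
    obtain ⟨p, hp⟩ := hT.exists_walk_length_eq_dist x y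
    rw [← hp, ← p.length_map g.toHom]
    exact SimpleGraph.dist_le _
  refine le_antisymm (key g x y) ?_
  simpa using key g.symm (g x) (g y)

theorem dist_inv_apply (hT : T.Connected) (g : T ≃g T) (x y : V) :
    T.dist (g⁻¹ x) y = T.dist x (g y) := by
  rw [← dist_apply_apply hT g]
  congr 1
  exact g.apply_symm_apply x

/-- A geodesic from `b` to `x` misses every vertex that is farther from `x` than `b`, so it
survives the removal of any edge at such a vertex. -/
theorem reachable_deleteEdges_of_dist_lt (hT : T.Connected) {a b x : V}
    (h : T.dist b x < T.dist a x) (c : V) : (T.deleteEdges {s(a, c)}).Reachable b x := by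
  classical
  obtain ⟨p, hp⟩ := hT.exists_walk_length_eq_dist b x
  have ha : a ∉ p.support := fun ha => by
    have h1 := p.length_dropUntil_le_length ha
    have h2 := SimpleGraph.dist_le (p.dropUntil a ha)
    omega
  refine ⟨p.toDeleteEdges _ fun e he hs => ha ?_⟩
  rw [Set.mem_singleton_iff] at hs
  subst hs
  exact p.fst_mem_support_of_mem_edges he

theorem not_mem_halfTree_of_mem_swap (hT : T.IsTree) {a b x : V} (hab : T.Adj a b)
    (h : x ∈ halfTree T a b) : x ∉ halfTree T b a := by
  intro h'
  have hbr := SimpleGraph.isBridge_iff.1 (SimpleGraph.isAcyclic_iff_forall_adj_isBridge.1 hT.2 hab)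
  have h'' : (T.deleteEdges {s(b, a)}).Reachable a x := h'
  rw [Sym2.eq_swap] at h''
  exact hbr (h''.trans (SimpleGraph.Reachable.symm h))

theorem mem_halfTree_iff_dist_lt (hT : T.IsTree) {a b x : V} (hab : T.Adj a b) :
    x ∈ halfTree T a b ↔ T.dist b x < T.dist a x := by
  refine ⟨fun h => ?_, fun h => reachable_deleteEdges_of_dist_lt hT.1 h b⟩
  by_contra hlt
  have hne := hT.dist_ne_of_adj x hab
  rw [SimpleGraph.dist_comm, SimpleGraph.dist_comm (u := x) (v := b)] at hne
  exact not_mem_halfTree_of_mem_swap hT hab h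
    (reachable_deleteEdges_of_dist_lt hT.1 (by omega) a)

theorem mem_halfTree_or_mem_swap (hT : T.IsTree) {a b : V} (hab : T.Adj a b) (x : V) :
    x ∈ halfTree T a b ∨ x ∈ halfTree T b a := by
  have hne := hT.dist_ne_of_adj x hab
  rw [SimpleGraph.dist_comm, SimpleGraph.dist_comm (u := x) (v := b)] at hne
  rw [mem_halfTree_iff_dist_lt hT hab, mem_halfTree_iff_dist_lt hT hab.symm]
  omega

theorem dist_eq_add_one_of_mem_halfTree (hT : T.IsTree) {a b x : V} (hab : T.Adj a b)
    (h : x ∈ halfTree T a b) : T.dist a x = T.dist b x + 1 := by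
  have h1 := (mem_halfTree_iff_dist_lt hT hab).1 h
  have h2 := hT.1.dist_triangle (u := a) (v := b) (w := x)
  have h3 := SimpleGraph.dist_eq_one_iff_adj.2 hab
  omega

/-- The half-trees at the neighbours of a vertex `a` that do not contain `a` are disjoint. -/
theorem eq_of_mem_halfTree (hT : T.IsTree) {a b b' x : V} (hab : T.Adj a b) (hab' : T.Adj a b')
    (h : x ∈ halfTree T a b) (h' : x ∈ halfTree T a b') : b = b' := by
  by_contra hne
  refine not_mem_halfTree_of_mem_swap hT hab h ?_
  have h1 := reachable_deleteEdges_of_dist_lt hT.1 ((mem_halfTree_iff_dist_lt hT hab').1 h') b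
  have h2 : (T.deleteEdges {s(a, b)}).Adj a b' := by
    rw [SimpleGraph.deleteEdges_adj]
    refine ⟨hab', fun h => ?_⟩
    rw [Set.mem_singleton_iff, Sym2.congr_right] at h
    exact hne h.symm
  change (T.deleteEdges {s(b, a)}).Reachable a x
  rw [Sym2.eq_swap]
  exact h2.reachable.trans h1

theorem exists_adj_dist_add_one (hT : T.Connected) {a x : V} (hne : a ≠ x) :
    ∃ b, T.Adj a b ∧ T.dist a x = T.dist b x + 1 := by
  obtain ⟨p, hp⟩ := hT.exists_walk_length_eq_dist a x
  cases p with
  | nil => exact absurd rfl hne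
  | @cons _ b _ hab q =>
    refine ⟨b, hab, ?_⟩
    rw [SimpleGraph.Walk.length_cons] at hp
    have h1 := SimpleGraph.dist_le q
    have h2 := hT.dist_triangle (u := a) (v := b) (w := x)
    have h3 := SimpleGraph.dist_eq_one_iff_adj.2 hab
    omega

theorem exists_adj_mem_halfTree (hT : T.IsTree) {a x : V} (hne : a ≠ x) :
    ∃ b, T.Adj a b ∧ x ∈ halfTree T a b := by
  obtain ⟨b, hab, h⟩ := exists_adj_dist_add_one hT.1 hne
  exact ⟨b, hab, (mem_halfTree_iff_dist_lt hT hab).2 (by omega)⟩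

/-- A half-tree can only be left through its root. -/
theorem mem_halfTree_of_adj {a b x y : V} (hx : x ∈ halfTree T a b) (hxy : T.Adj x y)
    (hxa : x ≠ a) (hxb : x ≠ b) : y ∈ halfTree T a b := by
  refine SimpleGraph.Reachable.trans hx (SimpleGraph.Adj.reachable ?_)
  rw [SimpleGraph.deleteEdges_adj]
  refine ⟨hxy, fun h => ?_⟩
  rw [Set.mem_singleton_iff, Sym2.eq_iff] at h
  rcases h with ⟨h, -⟩ | ⟨h, -⟩
  exacts [hxa h, hxb h]

theorem apply_mem_halfTree (g : T ≃g T) {a b x : V} (hx : x ∈ halfTree T a b) :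
    g x ∈ halfTree T (g a) (g b) := by
  let f : T.deleteEdges {s(a, b)} →g T.deleteEdges {s(g a, g b)} :=
    { toFun := g
      map_rel' := by
        intro p q hpq
        rw [SimpleGraph.deleteEdges_adj] at hpq ⊢
        refine ⟨g.map_adj_iff.2 hpq.1, fun h => hpq.2 ?_⟩
        rw [Set.mem_singleton_iff] at h ⊢
        exact Sym2.map.injective g.injective h }
  exact SimpleGraph.Reachable.map f hx

theorem finite_ball [T.LocallyFinite] (hT : T.Connected) (v : V) (n : ℕ) : (ball T v n).Finite := by
  induction n with
  | zero =>
    refine (Set.finite_singleton v).subset fun u hu => ?_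
    have h : T.dist v u = 0 := Nat.le_zero.1 hu
    exact (hT.dist_eq_zero_iff.1 h).symm
  | succ n ih =>
    refine (ih.union (ih.biUnion fun x _ => (T.neighborSet x).toFinite)).subset fun u hu => ?_
    have hu' : T.dist v u ≤ n + 1 := hu
    by_cases huv : u = v
    · subst huv
      exact Or.inl (by simp [ball])
    · obtain ⟨b, hab, h⟩ := exists_adj_dist_add_one hT huv
      rw [SimpleGraph.dist_comm, SimpleGraph.dist_comm (u := b)] at h
      exact Or.inr (Set.mem_biUnion (show T.dist v b ≤ n by omega) hab.symm)

/-! ### The permutation topology -/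

theorem tendsto_nhds_aut_iff {ι : Type*} {f : ι → T ≃g T} {l : Filter ι} {γ : T ≃g T} :
    Filter.Tendsto f l (nhds γ) ↔ ∀ x, ∀ᶠ i in l, f i x = γ x := by
  constructor
  · intro h x
    filter_upwards [h ((isOpen_basicNhd γ {x}).mem_nhds fun _ _ => rfl)] with i hi
    exact hi x (Finset.mem_singleton_self x)
  · intro h
    refine TopologicalSpace.tendsto_nhds_generateFrom_iff.2 ?_
    rintro _ ⟨g₀, F, rfl⟩ hγ
    have : ∀ᶠ i in l, ∀ x ∈ F, f i x = γ x := (Filter.eventually_all_finset F).2 fun x _ => h x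
    filter_upwards [this] with i hi x hx
    rw [hi x hx, hγ x hx]

/-- In a locally finite graph, the elements of a closed group that move a given vertex by a bounded
distance form a compact set. -/
theorem isCompact_setOf_dist_le [T.LocallyFinite] (hT : T.Connected) {G : Subgroup (T ≃g T)}
    (hG : IsClosed (G : Set (T ≃g T))) (v : V) (n : ℕ) :
    IsCompact {g : G | T.dist v ((g : T ≃g T) v) ≤ n} := by
  refine isCompact_iff_ultrafilter_le_nhds.2 fun U hU => ?_
  rw [Filter.le_principal_iff] at hU
  have lim : ∀ p : G → V → V, (∀ x, ∃ m, ∀ᶠ g in (U : Filter G), T.dist v (p g x) ≤ m) →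
      ∃ γ : V → V, ∀ x, ∀ᶠ g in (U : Filter G), p g x = γ x := by
    intro p hp
    suffices h : ∀ x, ∃ y, ∀ᶠ g in (U : Filter G), p g x = y by
      choose γ hγ using h
      exact ⟨γ, hγ⟩
    intro x
    obtain ⟨m, hm⟩ := hp x
    have h : ∀ᶠ g in (U : Filter G), ∃ y ∈ ball T v m, p g x = y :=
      hm.mono fun g hg => ⟨_, hg, rfl⟩
    obtain ⟨y, -, hy⟩ := (Ultrafilter.eventually_exists_mem_iff (finite_ball hT v m)).1 h
    exact ⟨y, hy⟩
  obtain ⟨γ, hγ⟩ := lim (fun g => (g : T ≃g T)) fun x => ⟨n + T.dist v x, by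
    filter_upwards [hU] with g hg
    have h1 := hT.dist_triangle (u := v) (v := (g : T ≃g T) v) (w := (g : T ≃g T) x)
    rw [dist_apply_apply hT] at h1
    have h2 : T.dist v ((g : T ≃g T) v) ≤ n := hg
    omega⟩
  obtain ⟨δ, hδ⟩ := lim (fun g => ((g : T ≃g T)⁻¹ : T ≃g T)) fun x => ⟨n + T.dist v x, by
    filter_upwards [hU] with g hg
    have h1 := hT.dist_triangle (u := (g : T ≃g T) v) (v := v) (w := x)
    rw [SimpleGraph.dist_comm, dist_inv_apply hT, SimpleGraph.dist_comm]
    rw [SimpleGraph.dist_comm (u := (g : T ≃g T) v) (v := v)] at h1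
    have h2 : T.dist v ((g : T ≃g T) v) ≤ n := hg
    omega⟩
  let Γ : T ≃g T :=
    { toFun := γ
      invFun := δ
      left_inv := fun x => by
        obtain ⟨g, h1, h2⟩ := ((hγ x).and (hδ (γ x))).exists
        rw [← h2, ← h1]
        exact (g : T ≃g T).symm_apply_apply x
      right_inv := fun x => by
        obtain ⟨g, h1, h2⟩ := ((hδ x).and (hγ (δ x))).exists
        rw [← h2, ← h1]
        exact (g : T ≃g T).apply_symm_apply x
      map_rel_iff' := by
        intro x y
        obtain ⟨g, h1, h2⟩ := ((hγ x).and (hγ y)).exists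
        change T.Adj (γ x) (γ y) ↔ _
        rw [← h1, ← h2]
        exact (g : T ≃g T).map_adj_iff }
  have htend : Filter.Tendsto (fun g : G => (g : T ≃g T)) U (nhds Γ) := tendsto_nhds_aut_iff.2 hγ
  have hΓ : Γ ∈ G := hG.mem_of_tendsto htend (Filter.Eventually.of_forall fun g => g.2)
  refine ⟨⟨Γ, hΓ⟩, ?_, tendsto_subtype_rng.2 htend⟩
  obtain ⟨g, h1, h2⟩ := ((hγ v).and hU).exists
  change T.dist v (γ v) ≤ n
  rw [← h1]
  exact h2

/-! ### Edge-transitivity -/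

theorem exists_apply_eq_of_localAction {G : Subgroup (T ≃g T)} {v x y : V} (hx : T.Adj v x)
    (hy : T.Adj v y) {σ : Equiv.Perm (T.incidenceSet v)} (hσ : σ ∈ localAction G v)
    (h : σ ⟨s(v, x), T.mk'_mem_incidenceSet_left_iff.2 hx⟩ =
      ⟨s(v, y), T.mk'_mem_incidenceSet_left_iff.2 hy⟩) :
    ∃ g ∈ G, g v = v ∧ g x = y := by
  obtain ⟨g, hg, hgv, hσ⟩ := hσ
  refine ⟨g, hg, hgv, ?_⟩
  have h1 := hσ ⟨s(v, x), T.mk'_mem_incidenceSet_left_iff.2 hx⟩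
  rw [h, Sym2.map_mk, hgv, Sym2.congr_right] at h1
  exact h1.symm

/-- A locally transitive group on a connected graph is transitive on undirected edges. -/
theorem exists_map_edge (hT : T.Connected) {G : Subgroup (T ≃g T)}
    (hG : ∀ v, MulAction.IsPretransitive (localAction G v) (T.incidenceSet v))
    {a b c d : V} (hab : T.Adj a b) (hcd : T.Adj c d) :
    ∃ g ∈ G, (g a = c ∧ g b = d) ∨ (g a = d ∧ g b = c) := by
  have loc : ∀ {x y z : V}, T.Adj x y → T.Adj x z → ∃ g ∈ G, g x = x ∧ g y = z := by
    intro x y z hy hz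
    obtain ⟨σ, h⟩ := (hG x).exists_smul_eq
      ⟨s(x, y), T.mk'_mem_incidenceSet_left_iff.2 hy⟩
      ⟨s(x, z), T.mk'_mem_incidenceSet_left_iff.2 hz⟩
    exact exists_apply_eq_of_localAction hy hz σ.2 h
  -- By induction along a walk from `a` to `c`, every edge at `c` is a translate of `s(a, b)`.
  suffices h : ∀ c, ∀ p : T.Walk c a, ∀ d, T.Adj c d →
      ∃ g ∈ G, (g a = c ∧ g b = d) ∨ (g a = d ∧ g b = c) by
    obtain ⟨p⟩ := hT.preconnected c a
    exact h c p d hcd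
  intro c p
  induction p with
  | nil =>
    intro d hd
    obtain ⟨g, hg, h1, h2⟩ := loc hab hd
    exact ⟨g, hg, Or.inl ⟨h1, h2⟩⟩
  | @cons c x _ hcx q ih =>
    intro d hd
    obtain ⟨g, hg, h⟩ := ih hab c hcx.symm
    obtain ⟨k, hk, h1, h2⟩ := loc hcx hd
    refine ⟨k * g, G.mul_mem hk hg, ?_⟩
    rcases h with ⟨ha, hb⟩ | ⟨ha, hb⟩
    · exact Or.inr ⟨by rw [RelIso.mul_apply, ha, h2], by rw [RelIso.mul_apply, hb, h1]⟩
    · exact Or.inl ⟨by rw [RelIso.mul_apply, ha, h1], by rw [RelIso.mul_apply, hb, h2]⟩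

/-! ### Rays following a direction -/

section Direction

variable {W : Ultrafilter V}

theorem exists_adj_halfTree_mem [T.LocallyFinite] (hT : T.IsTree)
    (hW : (W : Filter V) ≤ Filter.cofinite) (a : V) : ∃ b, T.Adj a b ∧ halfTree T a b ∈ W := by
  have h : ∀ᶠ x in (W : Filter V), ∃ b ∈ T.neighborSet a, x ∈ halfTree T a b := by
    filter_upwards [hW (Set.finite_singleton a).compl_mem_cofinite] with x hx
    exact exists_adj_mem_halfTree hT fun h => hx h.symm
  exact (Ultrafilter.eventually_exists_mem_iff (T.neighborSet a).toFinite).1 h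

theorem halfTree_mem_or_mem_swap (hT : T.IsTree) {a b : V} (hab : T.Adj a b) :
    halfTree T a b ∈ W ∨ halfTree T b a ∈ W :=
  Ultrafilter.union_mem_iff.1 (Filter.mem_of_superset Filter.univ_mem fun x _ =>
    mem_halfTree_or_mem_swap hT hab x)

theorem eq_of_halfTree_mem (hT : T.IsTree) {a b b' : V} (hab : T.Adj a b) (hab' : T.Adj a b')
    (h : halfTree T a b ∈ W) (h' : halfTree T a b' ∈ W) : b = b' := by
  obtain ⟨x, hx, hx'⟩ := W.nonempty_of_mem (Filter.inter_mem h h')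
  exact eq_of_mem_halfTree hT hab hab' hx hx'

variable {next : V → V}

/-- The distance to a point near the end decreases by one along each step towards the end. -/
theorem eventually_dist_iterate (hT : T.IsTree)
    (hnext : ∀ a, T.Adj a (next a) ∧ halfTree T a (next a) ∈ W) (a : V) (n : ℕ) :
    ∀ᶠ x in (W : Filter V), T.dist (next^[n] a) x + n = T.dist a x := by
  induction n with
  | zero => simp
  | succ n ih =>
    filter_upwards [ih, (hnext (next^[n] a)).2] with x h1 h2
    have h3 := dist_eq_add_one_of_mem_halfTree hT (hnext _).1 h2
    rw [Function.iterate_succ_apply']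
    omega

theorem iterate_injective_of_halfTree_mem (hT : T.IsTree)
    (hnext : ∀ a, T.Adj a (next a) ∧ halfTree T a (next a) ∈ W) (a : V) :
    Function.Injective fun n => next^[n] a := by
  intro i j hij
  obtain ⟨x, h1, h2⟩ :=
    ((eventually_dist_iterate hT hnext a i).and (eventually_dist_iterate hT hnext a j)).exists
  have h3 : next^[i] a = next^[j] a := hij
  rw [h3] at h1
  omega

/-- The ray from `a` that always steps towards the end given by `W`, where `next a` is the neighbour
of `a` in the direction of that end. -/
def iterateRay (hT : T.IsTree)
    (hnext : ∀ a, T.Adj a (next a) ∧ halfTree T a (next a) ∈ W) (a : V) : Ray T where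
  toFun n := next^[n] a
  adj n := by
    rw [Function.iterate_succ_apply']
    exact (hnext _).1
  inj := iterate_injective_of_halfTree_mem hT hnext a

/-- Of two adjacent vertices, one is the successor of the other, so any two rays following the
direction merge. -/
theorem exists_iterate_eq_iterate (hT : T.IsTree)
    (hnext : ∀ a, T.Adj a (next a) ∧ halfTree T a (next a) ∈ W) (a b : V) :
    ∃ m n, next^[m] a = next^[n] b := by
  obtain ⟨p⟩ := hT.1.preconnected a b
  induction p with
  | nil => exact ⟨0, 0, rfl⟩
  | @cons a c _ hac q ih =>
    obtain ⟨m, n, h⟩ := ih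
    rcases halfTree_mem_or_mem_swap (W := W) hT hac with h' | h'
    · have hc := eq_of_halfTree_mem hT hac (hnext a).1 h' (hnext a).2
      exact ⟨m + 1, n, by rw [Function.iterate_succ_apply, ← hc, h]⟩
    · have hc := eq_of_halfTree_mem hT hac.symm (hnext c).1 h' (hnext c).2
      refine ⟨m, n + 1, ?_⟩
      rw [Function.iterate_succ_apply', ← h, ← Function.iterate_succ_apply' next,
        Function.iterate_succ_apply, ← hc]

theorem iterateRay_equivalent (hT : T.IsTree)
    (hnext : ∀ a, T.Adj a (next a) ∧ halfTree T a (next a) ∈ W) (a b : V) :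
    (iterateRay hT hnext a).Equivalent (iterateRay hT hnext b) := by
  classical
  have hex : ∃ m, ∃ n, next^[m] a = next^[n] b := exists_iterate_eq_iterate hT hnext a b
  -- The intersection is the ray from the first vertex at which the two rays meet.
  obtain ⟨n, hn⟩ := Nat.find_spec hex
  refine ⟨iterateRay hT hnext (next^[Nat.find hex] a), Set.ext fun x => ?_⟩
  constructor
  · rintro ⟨i, rfl⟩
    refine ⟨⟨i + Nat.find hex, Function.iterate_add_apply ..⟩, ⟨i + n, ?_⟩⟩
    change next^[i + n] b = next^[i] (next^[Nat.find hex] a)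
    rw [hn, Function.iterate_add_apply]
  · rintro ⟨⟨i, rfl⟩, ⟨j, hj⟩⟩
    have hi : Nat.find hex ≤ i := Nat.find_min' hex ⟨j, hj.symm⟩
    refine ⟨i - Nat.find hex, ?_⟩
    change next^[i - Nat.find hex] (next^[Nat.find hex] a) = next^[i] a
    rw [← Function.iterate_add_apply, Nat.sub_add_cancel hi]

/-- Let `G` be transitive on undirected edges and fix no end. Then for every edge and each end, some
translate of the edge, taken with its orientation, points to the end. Otherwise every oriented edge
pointing to the end lies in the orbit of the reversed edge, so `G` preserves the set of these
oriented edges, and with it the end. -/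
theorem exists_halfTree_apply_mem [T.LocallyFinite] (hT : T.IsTree) {G : Subgroup (T ≃g T)}
    (hG : ∀ v, MulAction.IsPretransitive (localAction G v) (T.incidenceSet v))
    (hend : ¬ FixesEnd G) (hW : (W : Filter V) ≤ Filter.cofinite) {v w : V} (hvw : T.Adj v w) :
    ∃ g ∈ G, halfTree T (g v) (g w) ∈ W := by
  by_contra! hno
  have hinv : ∀ a b, T.Adj a b → halfTree T a b ∈ W → ∀ h ∈ G, halfTree T (h a) (h b) ∈ W := by
    intro a b hab hmem h hh
    obtain ⟨g, hg, ⟨rfl, rfl⟩ | ⟨rfl, rfl⟩⟩ := exists_map_edge hT.1 hG hvw hab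
    · exact absurd hmem (hno g hg)
    · exact (halfTree_mem_or_mem_swap hT (h.map_adj_iff.2 hab)).resolve_right
        (hno (h * g) (G.mul_mem hh hg))
  choose next hnext using exists_adj_halfTree_mem (W := W) hT hW
  have hcomm : ∀ h ∈ G, ∀ a, h (next a) = next (h a) := fun h hh a =>
    eq_of_halfTree_mem hT (h.map_adj_iff.2 (hnext a).1) (hnext _).1
      (hinv _ _ (hnext a).1 (hnext a).2 h hh) (hnext _).2
  refine hend ⟨iterateRay hT hnext v, fun h hh => ?_⟩
  have hmap : (iterateRay hT hnext v).map h = iterateRay hT hnext (h v) := by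
    have : ∀ n, h (next^[n] v) = next^[n] (h v) := fun n => by
      induction n with
      | zero => rfl
      | succ n ih => rw [Function.iterate_succ_apply', hcomm h hh, ih, Function.iterate_succ_apply']
    unfold Ray.map
    congr 1
    exact funext this
  rw [hmap]
  exact iterateRay_equivalent hT hnext _ _

end Direction

/-! ### Homomorphisms whose range is not closed -/

/-- If `φ : G → H` does not have closed range, then its kernel contains the fixator of every
half-tree: along an ultrafilter on `G` that escapes to an end and on which `φ` converges, an element
`u` fixing a half-tree around this end satisfies `g⁻¹ * u * g → 1`, whereas `φ (g⁻¹ * u * g)`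
converges to a conjugate of `φ u`. -/
theorem map_eq_one_of_fixes_halfTree [T.LocallyFinite] (hT : T.IsTree) {G : Subgroup (T ≃g T)}
    (hclosed : IsClosed (G : Set (T ≃g T)))
    (hG : ∀ v, MulAction.IsPretransitive (localAction G v) (T.incidenceSet v))
    (hend : ¬ FixesEnd G) {H : Type w} [Group H] [TopologicalSpace H] [IsTopologicalGroup H]
    [T2Space H] {φ : G →* H} (hφ : Continuous φ) (hrange : ¬ IsClosed (Set.range φ))
    {v w : V} (hvw : T.Adj v w) {u : G} (hu : ∀ x ∈ halfTree T v w, (u : T ≃g T) x = x) :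
    φ u = 1 := by
  obtain ⟨h, hcl, hnot⟩ : ∃ h ∈ closure (Set.range φ), h ∉ Set.range φ := by
    by_contra! hsub
    exact hrange (isClosed_of_closure_subset hsub)
  have : (Filter.comap φ (nhds h)).NeBot := by
    rwa [Filter.comap_neBot_iff_frequently, ← mem_closure_iff_frequently]
  let U : Ultrafilter G := Ultrafilter.of (Filter.comap φ (nhds h))
  have hlim : Filter.Tendsto φ U (nhds h) :=
    Filter.tendsto_iff_comap.2 (Ultrafilter.of_le _)
  -- A cluster point of `U` in `G` would be mapped to `h`, so `U` leaves every compact set.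
  have hfar : ∀ x y, ∀ᶠ g : G in (U : Filter G), (g : T ≃g T) x ≠ y := by
    intro x y
    rw [← Ultrafilter.frequently_iff_eventually]
    by_contra hev
    rw [Filter.not_frequently] at hev
    have hK : {g : G | T.dist x ((g : T ≃g T) x) ≤ T.dist x y} ∈ (U : Filter G) := by
      filter_upwards [hev] with g hg
      rw [not_not.1 hg]
    obtain ⟨γ, -, hγ⟩ := isCompact_iff_ultrafilter_le_nhds.1
      (isCompact_setOf_dist_le hT.1 hclosed x (T.dist x y)) U (Filter.le_principal_iff.2 hK)
    exact hnot ⟨γ, tendsto_nhds_unique ((hφ.tendsto γ).mono_left hγ) hlim⟩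
  let W : Ultrafilter V := U.map fun g : G => (g : T ≃g T) v
  have hW : (W : Filter V) ≤ Filter.cofinite :=
    Filter.le_cofinite_iff_eventually_ne.2 fun y => hfar v y
  obtain ⟨g₀, hg₀, hmem⟩ := exists_halfTree_apply_mem hT hG hend hW hvw
  have hnear : ∀ x, ∀ᶠ g : G in (U : Filter G), (g : T ≃g T) x ∈ halfTree T (g₀ v) (g₀ w) := by
    intro x
    have hxv := (SimpleGraph.reachable_iff_reflTransGen x v).1 (hT.1.preconnected x v)
    induction hxv using Relation.ReflTransGen.head_induction_on with
    | refl => exact hmem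
    | @head x y hxy _ ih =>
      filter_upwards [ih, hfar y (g₀ _), hfar y (g₀ w)] with g h1 h2 h3
      exact mem_halfTree_of_adj h1 ((g : T ≃g T).map_adj_iff.2 hxy.symm) h2 h3
  let k : G := ⟨g₀, hg₀⟩
  have hk : ∀ x ∈ halfTree T (g₀ v) (g₀ w), ((k * u * k⁻¹ : G) : T ≃g T) x = x := by
    intro x hx
    have h1 : g₀⁻¹ x ∈ halfTree T v w := by
      have h2 := apply_mem_halfTree g₀⁻¹ hx
      rwa [RelIso.inv_apply_self, RelIso.inv_apply_self] at h2
    change g₀ ((u : T ≃g T) (g₀⁻¹ x)) = x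
    rw [hu _ h1, RelIso.apply_inv_self]
  have hconj : Filter.Tendsto (fun g : G => g⁻¹ * (k * u * k⁻¹) * g) U (nhds 1) := by
    refine tendsto_subtype_rng.2 (tendsto_nhds_aut_iff.2 fun x => ?_)
    filter_upwards [hnear x] with g hg
    change (g : T ≃g T)⁻¹ (((k * u * k⁻¹ : G) : T ≃g T) ((g : T ≃g T) x)) = x
    rw [hk _ hg, RelIso.inv_apply_self]
  have h1 := (hφ.tendsto 1).comp hconj
  have h2 : Filter.Tendsto (fun g : G => φ (g⁻¹ * (k * u * k⁻¹) * g)) U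
      (nhds (h⁻¹ * φ (k * u * k⁻¹) * h)) := by
    simp only [map_mul φ _ (_ : G), map_inv φ (_ : G)]
    exact (hlim.inv.mul tendsto_const_nhds).mul hlim
  have h3 := tendsto_nhds_unique h1 h2
  rw [map_one] at h3
  have h4 : φ (k * u * k⁻¹) = 1 := by
    have h5 : φ (k * u * k⁻¹) = h * (h⁻¹ * φ (k * u * k⁻¹) * h) * h⁻¹ := by group
    rw [h5, ← h3, mul_one, mul_inv_cancel]
  rwa [map_mul, map_mul, map_inv, mul_inv_eq_one, mul_eq_left] at h4

/-! ### Normal subgroups of locally semi-primitive groups -/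

theorem exists_mem_localAction {G : Subgroup (T ≃g T)} {g : T ≃g T} (hg : g ∈ G) {v : V}
    (hgv : g v = v) : ∃ σ ∈ localAction G v, ∀ e, (σ e : Sym2 V) = Sym2.map g e := by
  have hmem : ∀ h : T ≃g T, h v = v → ∀ e ∈ T.incidenceSet v, Sym2.map h e ∈ T.incidenceSet v := by
    intro h hv e he
    induction e with
    | h x y =>
      rw [Sym2.map_mk, SimpleGraph.mk'_mem_incidenceSet_iff] at *
      refine ⟨h.map_adj_iff.2 he.1, ?_⟩
      rcases he.2 with rfl | rfl
      exacts [Or.inl hv.symm, Or.inr hv.symm]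
  have hgv' : g.symm v = v := by rw [RelIso.symm_apply_eq, hgv]
  let σ : Equiv.Perm (T.incidenceSet v) :=
    { toFun := fun e => ⟨Sym2.map g e, hmem g hgv e e.2⟩
      invFun := fun e => ⟨Sym2.map g.symm e, hmem g.symm hgv' e e.2⟩
      left_inv := fun e => Subtype.ext <| by
        change Sym2.map g.symm (Sym2.map g e) = e
        rw [Sym2.map_map, show ⇑g.symm ∘ ⇑g = id from funext g.symm_apply_apply, Sym2.map_id, id]
      right_inv := fun e => Subtype.ext <| by
        change Sym2.map g (Sym2.map g.symm e) = e
        rw [Sym2.map_map, show ⇑g ∘ ⇑g.symm = id from funext g.apply_symm_apply, Sym2.map_id, id] }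
  exact ⟨σ, ⟨g, hg, hgv, fun _ => rfl⟩, fun _ => rfl⟩

variable {G N : Subgroup (T ≃g T)}

/-- At each vertex, the local action of a normal subgroup of a locally semi-primitive group is
transitive or semi-regular. -/
theorem locally_transitive_or_semiregular (hlocal : IsLocallySemiprimitive G) (hNG : N ≤ G)
    (hN : ∀ g ∈ G, ∀ n ∈ N, g * n * g⁻¹ ∈ N) (v : V) :
    (∀ x y, T.Adj v x → T.Adj v y → ∃ n ∈ N, n v = v ∧ n x = y) ∨
      ∀ n ∈ N, n v = v → ∀ x, T.Adj v x → n x = x → ∀ y, T.Adj v y → n y = y := by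
  have hnormal : ((localAction N v).subgroupOf (localAction G v)).Normal := by
    refine ⟨?_⟩
    rintro ⟨τ, hτ⟩ hτN ⟨σ, hσ⟩
    rw [Subgroup.mem_subgroupOf] at hτN ⊢
    obtain ⟨n, hn, hnv, hn'⟩ := hτN
    obtain ⟨g, hg, hgv, hg'⟩ := id hσ
    refine ⟨g * n * g⁻¹, hN g hg n hn, ?_, fun e => ?_⟩
    · have hgv' : g.symm v = v := by rw [RelIso.symm_apply_eq, hgv]
      change g (n (g.symm v)) = v
      rw [hgv', hnv, hgv]
    · obtain ⟨f, rfl⟩ := σ.surjective e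
      change ((σ (τ (σ.symm (σ f))) : T.incidenceSet v) : Sym2 V) = _
      rw [σ.symm_apply_apply, hg', hn', hg', Sym2.map_map, Sym2.map_map]
      congr 1
      funext x
      change g (n x) = g (n (g.symm (g x)))
      rw [g.symm_apply_apply]
  rcases (hlocal v).2 _ hnormal with htrans | hreg
  · refine Or.inl fun x y hx hy => ?_
    obtain ⟨⟨σ, hσ⟩, h⟩ := htrans.exists_smul_eq
      ⟨s(v, x), T.mk'_mem_incidenceSet_left_iff.2 hx⟩
      ⟨s(v, y), T.mk'_mem_incidenceSet_left_iff.2 hy⟩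
    exact exists_apply_eq_of_localAction hx hy (Subgroup.mem_subgroupOf.1 hσ) h
  · refine Or.inr fun n hn hnv x hx hnx y hy => ?_
    obtain ⟨σ, hσN, hσ⟩ := exists_mem_localAction hn hnv
    have hσG : σ ∈ localAction G v := ⟨n, hNG hn, hnv, hσ⟩
    have h1 := hreg ⟨σ, hσG⟩ (Subgroup.mem_subgroupOf.2 hσN)
      ⟨s(v, x), T.mk'_mem_incidenceSet_left_iff.2 hx⟩ (Subtype.ext <| by
        change (σ _ : Sym2 V) = _
        rw [hσ, Sym2.map_mk, hnv, hnx])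
    have h2 := hσ ⟨s(v, y), T.mk'_mem_incidenceSet_left_iff.2 hy⟩
    rw [show σ = 1 from congrArg Subtype.val h1, Equiv.Perm.one_apply, Sym2.map_mk, hnv,
      Sym2.congr_right] at h2
    exact h2.symm

/-- If a group acts semi-regularly on the edges at each vertex, then only the identity fixes an edge
together with its end points. -/
theorem eq_one_of_locally_semiregular (hT : T.Connected)
    (hN : ∀ v, ∀ n ∈ N, n v = v → ∀ x, T.Adj v x → n x = x → ∀ y, T.Adj v y → n y = y)
    {a b : V} (hab : T.Adj a b) {n : T ≃g T} (hn : n ∈ N) (ha : n a = a) (hb : n b = b) :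
    n = 1 := by
  have key : ∀ z, ∀ p : T.Walk z a, n z = z ∧ ∀ y, T.Adj z y → n y = y := by
    intro z p
    induction p with
    | nil => exact ⟨ha, hN _ n hn ha b hab hb⟩
    | @cons z x _ hzx q ih =>
      obtain ⟨h1, h2⟩ := ih hab ha
      exact ⟨h2 z hzx.symm, hN z n hn (h2 z hzx.symm) x hzx h1⟩
  refine RelIso.ext fun z => ?_
  obtain ⟨p⟩ := hT.preconnected z a
  exact (key z p).1

/-- A normal subgroup that is transitive on the edges at one vertex `v` has finitely many orbits:
each vertex can be moved into the ball of radius 2 around `v`. By edge-transitivity of `G`, one of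
the next two vertices on the way to `v` is a translate of `v`, and the stabiliser of that vertex
in the normal subgroup folds the path there. -/
theorem exists_dist_apply_le_two (hT : T.Connected)
    (hG : ∀ v, MulAction.IsPretransitive (localAction G v) (T.incidenceSet v))
    (hN : ∀ g ∈ G, ∀ n ∈ N, g * n * g⁻¹ ∈ N) {v : V}
    (hv : ∀ x y, T.Adj v x → T.Adj v y → ∃ n ∈ N, n v = v ∧ n x = y) (z : V) :
    ∃ n ∈ N, T.dist v (n z) ≤ 2 := by
  have htrans : ∀ g ∈ G, ∀ x y, T.Adj (g v) x → T.Adj (g v) y → ∃ n ∈ N, n x = y := by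
    intro g hg x y hx hy
    have hadj : ∀ x, T.Adj (g v) x → T.Adj v (g⁻¹ x) := fun x hx => by
      rw [← g.map_adj_iff, RelIso.apply_inv_self]
      exact hx
    obtain ⟨n, hn, -, h⟩ := hv _ _ (hadj x hx) (hadj y hy)
    refine ⟨g * n * g⁻¹, hN g hg n hn, ?_⟩
    change g (n (g⁻¹ x)) = y
    rw [h, RelIso.apply_inv_self]
  induction hd : T.dist v z using Nat.strong_induction_on generalizing z with
  | _ d ih =>
  by_cases hd2 : d ≤ 2
  · exact ⟨1, N.one_mem, hd.trans_le hd2⟩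
  have step : ∀ x, 0 < T.dist v x → ∃ y, T.Adj x y ∧ T.dist v x = T.dist v y + 1 := by
    intro x hx
    have hne : x ≠ v := by
      rintro rfl
      simp at hx
    obtain ⟨y, hxy, h⟩ := exists_adj_dist_add_one hT hne
    rw [SimpleGraph.dist_comm, SimpleGraph.dist_comm (u := y)] at h
    exact ⟨y, hxy, h⟩
  obtain ⟨z₁, hz₁, h1⟩ := step z (by omega)
  obtain ⟨z₂, hz₂, h2⟩ := step z₁ (by omega)
  obtain ⟨z₃, hz₃, h3⟩ := step z₂ (by omega)
  suffices h : ∃ n ∈ N, T.dist v (n z) < d by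
    obtain ⟨n, hn, hlt⟩ := h
    obtain ⟨m, hm, hle⟩ := ih _ hlt (n z) rfl
    exact ⟨m * n, N.mul_mem hm hn, hle⟩
  obtain ⟨y, hvy, -⟩ : ∃ y, T.Adj v y ∧ T.dist v z = T.dist y z + 1 :=
    exists_adj_dist_add_one hT (by rintro rfl; simp at hd; omega)
  obtain ⟨g, hg, ⟨hgv, -⟩ | ⟨hgv, -⟩⟩ := exists_map_edge hT hG hvy hz₂
  · obtain ⟨n, hn, h⟩ := htrans g hg z z₂ (hgv ▸ hz₁.symm) (hgv ▸ hz₂)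
    exact ⟨n, hn, by rw [h]; omega⟩
  · obtain ⟨n, hn, h⟩ := htrans g hg z₁ z₃ (hgv ▸ hz₂.symm) (hgv ▸ hz₃)
    refine ⟨n, hn, ?_⟩
    have h4 := hT.dist_triangle (u := v) (v := n z₁) (w := n z)
    rw [dist_apply_apply hT, SimpleGraph.dist_eq_one_iff_adj.2 hz₁.symm, h] at h4
    omega

end TreeAut

open TreeAut in
theorem mainTheorem5 {V : Type u} [Infinite V] (T : SimpleGraph V) [T.LocallyFinite]
    (hT : T.IsTree) (hleaf : ∀ v : V, T.degree v ≠ 1)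
    (G : Subgroup (T ≃g T)) (k : ℕ)
    (hclosed : IsClosed (G : Set (T ≃g T)))
    (hnondiscrete : ¬ DiscreteTopology G)
    (hlocal : TreeAut.IsLocallySemiprimitive G)
    (hsubtree : ¬ TreeAut.StabilisesProperSubtree G)
    (hend : ¬ TreeAut.FixesEnd G)
    (hP : TreeAut.PropertyP G k) :
    TreeAut.HasClosedRangeProperty.{u, w} G := by
  intro H _ _ _ _ φ hφ
  -- If the range is not closed, the kernel is large, which in turn makes the range compact.
  by_contra hrange
  refine hrange ?_
  have hG : ∀ v, MulAction.IsPretransitive (localAction G v) (T.incidenceSet v) :=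
    fun v => (hlocal v).1
  let N : Subgroup (T ≃g T) := φ.ker.map G.subtype
  have hNG : N ≤ G := Subgroup.map_subtype_le _
  have hN : ∀ g ∈ G, ∀ n ∈ N, g * n * g⁻¹ ∈ N := by
    intro g hg n hn
    obtain ⟨m, hm, rfl⟩ := Subgroup.mem_map.1 hn
    refine Subgroup.mem_map.2 ⟨(⟨g, hg⟩ : G) * m * (⟨g, hg⟩ : G)⁻¹, ?_, rfl⟩
    exact (MonoidHom.normal_ker φ).conj_mem m hm _
  have hfix : ∀ a b, T.Adj a b → edgeFixator G k a b ≤ N := by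
    have half : ∀ a b c d, T.Adj c d → fixator (edgeFixator G k a b) (halfTree T c d) ≤ N :=
      fun a b c d hcd u hu => ⟨⟨u, hu.1.1⟩,
        map_eq_one_of_fixes_halfTree hT hclosed hG hend hφ hrange hcd hu.2, rfl⟩
    intro a b hab u hu
    have hu' : u ∈ (edgeFixator G k a b : Set (T ≃g T)) := hu
    rw [hP a b hab] at hu'
    obtain ⟨x, hx, y, hy, rfl⟩ := hu'
    exact N.mul_mem (half a b a b hab hx) (half a b b a hab.symm hy)
  obtain ⟨v, hv⟩ : ∃ v, ∀ x y, T.Adj v x → T.Adj v y → ∃ n ∈ N, n v = v ∧ n x = y := by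
    by_contra! hno
    have hreg : ∀ v, ∀ n ∈ N, n v = v → ∀ x, T.Adj v x → n x = x → ∀ y, T.Adj v y → n y = y := by
      intro v
      refine (locally_transitive_or_semiregular hlocal hNG hN v).resolve_left fun h => ?_
      obtain ⟨x, y, hx, hy, hxy⟩ := hno v
      obtain ⟨n, hn, hnv, hnx⟩ := h x y hx hy
      exact hxy n hn hnv hnx
    obtain ⟨a, a', hne⟩ := exists_pair_ne V
    obtain ⟨b, hab, -⟩ := exists_adj_dist_add_one hT.1 hne
    -- The open subgroup `edgeFixator G k a b` meets the stabiliser of `a` and `b` trivially.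
    let F : Finset V := ((finite_ball hT.1 a k).union (Set.toFinite {a, b})).toFinset
    refine hnondiscrete (discreteTopology_of_isOpen_singleton_one ?_)
    have hopen := (isOpen_basicNhd (1 : T ≃g T) F).preimage (continuous_subtype_val (p := (· ∈ G)))
    convert hopen
    ext g
    constructor
    · rintro rfl x -
      rfl
    · intro hg
      have hgx : ∀ x ∈ ball T a k ∪ {a, b}, (g : T ≃g T) x = x := fun x hx =>
        hg x ((Set.Finite.mem_toFinset _).2 hx)
      exact Subtype.ext (eq_one_of_locally_semiregular hT.1 hreg hab
        (hfix a b hab ⟨g.2, fun x hx => hgx x (Or.inl hx.1)⟩) (hgx a (by simp)) (hgx b (by simp)))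
  -- The range is the image of the compact set of elements moving `v` by at most 2.
  convert ((isCompact_setOf_dist_le hT.1 hclosed v 2).image hφ).isClosed
  refine Set.Subset.antisymm ?_ (Set.image_subset_range _ _)
  rintro _ ⟨g, rfl⟩
  obtain ⟨_, ⟨n, hn, rfl⟩, h⟩ := exists_dist_apply_le_two hT.1 hG hN hv ((g : T ≃g T) v)
  refine ⟨n * g, h, ?_⟩
  rw [map_mul, show φ n = 1 from hn, one_mul]
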